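/- Let $z>0$, $2z<\beta\le 2zn$, let $B=[0,\beta]$, and let $x_1\le\dots\le x_n$ be the locations of sensors $s_1,\dots,s_n$ on the real line; a sensor at $p$ covers $[p-z,p+z]$. For a set of sensors with given initial locations, the *min-sum value* is the infimum, over all relocations after which every point of $B$ is covered by at least one sensor of the set, of the sum of the moving distances of the sensors in the set. Let $D_{opt}$ be the min-sum value for all $n$ sensors at $x_1,\dots,x_n$, and let $\lambda=\lceil\beta/(2z)\rceil$. Assume that $[x_t-z,x_t+z]\cap B\neq\emptyset$ for some $t$, let $l$ (resp. $r$) be the smallest (resp. largest) such $t$, and write $S(i,j)=\{s_i,\dots,s_j\}$, $S_I=S(l,r)$. For $1\le i\le l$ and $r\le j\le n$ put $D(i,j)=+\infty$ if $|S(i,j)|<\lambda$, and otherwise $$D(i,j)=D_c(i,j)+\sum_{t=i}^{l-1}(-z-x_t)+\sum_{t=r+1}^{j}(x_t-z-\beta),$$ where $D_c(i,j)$ is the min-sum value for the sensors $S(i,j)$ when $s_t$ initially lies at $-z$ for $t<l$, at $\beta+z$ for $t>r$, and at $x_t$ for $l\le t\le r$. Call $j\in[r,n]$ a *best right index* for $i$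 if $D(i,j)=\min_{r\le j'\le n}D(i,j')$, and $i\in[1,l]$ a *best left index* for $j$ if $D(i,j)=\min_{1\le i'\le l}D(i',j)$. Call $(i,j)$ with $1\le i\le l$, $r\le j\le n$ an *optimal pair* if $D(i,j)=D_{opt}$. Let $(l^*,r^*)$ be any optimal pair. 1. If $|S_I|\ge\lambda$, then for every $i\in[1,l]$ the index $r^*$ is a best right index for $i$, and the set of best right indices for $i$ is exactly $\{j:(l^*,j)\text{ is an optimal pair}\}$, independently of $i$. Likewise, for every $j\in[r,n]$ the index $l^*$ is a best left index for $j$, and the set of best left indices for $j$ is exactly $\{i:(i,r^*)\text{ is an optimal pair}\}$. 2. If $|S(l^*,r^*)|\ge\lambda+1$, then for every $i$ with $1\le i<l^*$ the index $r^*$ is a best right index for $i$. Moreover, if $r^*$ is the smallest (resp. largest) best right index for $l^*$, then it is the smallest (resp. largest) best right index for $i$. 3. In particular, if $|S_I|\ge\lambda$ or $|S(l^*,r^*)|\ge\lambda+1$, then $r^*$ is a best right index for $i=1$, that is, $r^*$ minimizes $D(1,\cdot)$ over $[r,n]$; and if $r^*$ is the smallest (resp. largest) best right index for $l^*$, then it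 is the smallest (resp. largest) best right index for $1$. -/

import Mathlib

namespace BarrierCoverage

/-- The covering interval of a sensor of range `z` located at `p`. -/
def coverInterval (z p : ℝ) : Set ℝ := Set.Icc (p - z) (p + z)

/-- The barrier `[0, β]` is fully covered by the sensors with indices in `T` at locations `y`. -/
def Covers (β z : ℝ) (T : Finset ℕ) (y : ℕ → ℝ) : Prop :=
  Set.Icc 0 β ⊆ ⋃ t ∈ T, coverInterval z (y t)

/-- Sum of the moving distances of the sensors in `T` from locations `x` to locations `y`. -/
def moveCost (T : Finset ℕ) (x y : ℕ → ℝ) : ℝ := ∑ t ∈ T, |x t - y t|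

/-- Optimal value of the min-sum barrier coverage instance consisting of the sensors in `T`,
initially at locations `x`. It is only used when `T` has enough sensors to cover the barrier. -/
noncomputable def minSum (β z : ℝ) (T : Finset ℕ) (x : ℕ → ℝ) : ℝ :=
  sInf {c | ∃ y : ℕ → ℝ, Covers β z T y ∧ c = moveCost T x y}

/-- The least number `λ` of sensors of range `z` that can cover `[0, β]`. -/
noncomputable def minSensors (β z : ℝ) : ℕ := ⌈β / (2 * z)⌉₊

/-- Indices in `1, …, n` of the sensors whose covering interval meets the barrier. -/
def meeting (β z : ℝ) (n : ℕ) (x : ℕ → ℝ) : Set ℕ :=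
  {t | t ∈ Set.Icc 1 n ∧ (coverInterval z (x t) ∩ Set.Icc 0 β).Nonempty}

/-- Locations after the sensors left of `s_l` are moved to `-z` and those right of `s_r` are
moved to `β + z`. -/
noncomputable def manualMove (β z : ℝ) (l r : ℕ) (x : ℕ → ℝ) : ℕ → ℝ :=
  fun t => if t < l then -z else if r < t then β + z else x t

/-- Cost of moving `s_i, …, s_{l-1}` rightwards to `-z`. -/
def costLeft (z : ℝ) (l : ℕ) (x : ℕ → ℝ) (i : ℕ) : ℝ := ∑ t ∈ Finset.Ico i l, (-z - x t)

/-- Cost of moving `s_{r+1}, …, s_j` leftwards to `β + z`. -/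
def costRight (β z : ℝ) (r : ℕ) (x : ℕ → ℝ) (j : ℕ) : ℝ := ∑ t ∈ Finset.Ioc r j, (x t - z - β)

/-- Optimal value `D_c(i, j)` of the containing-case instance formed by the sensors
`s_i, …, s_j` after the manual movements. -/
noncomputable def containCost (β z : ℝ) (l r : ℕ) (x : ℕ → ℝ) (i j : ℕ) : ℝ :=
  minSum β z (Finset.Icc i j) (manualMove β z l r x)

/-- `D(i, j)`, which is `+∞` if `s_i, …, s_j` are too few to cover the barrier. -/
noncomputable def totalCost (β z : ℝ) (l r : ℕ) (x : ℕ → ℝ) (i j : ℕ) : EReal :=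
  if (Finset.Icc i j).card < minSensors β z then ⊤
  else ((containCost β z l r x i j + (costLeft z l x i + costRight β z r x j) : ℝ) : EReal)

/-- The best right indices for the left index `i`: all minimizers of `D(i, ·)` over `[r, n]`. -/
def bestRight (β z : ℝ) (n l r : ℕ) (x : ℕ → ℝ) (i : ℕ) : Set ℕ :=
  {j | j ∈ Set.Icc r n ∧
    ∀ j' ∈ Set.Icc r n, totalCost β z l r x i j ≤ totalCost β z l r x i j'}

/-- The best left indices for the right index `j`: all minimizers of `D(·, j)` over `[1, l]`. -/
def bestLeft (β z : ℝ) (l r : ℕ) (x : ℕ → ℝ) (j : ℕ) : Set ℕ :=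
  {i | i ∈ Set.Icc 1 l ∧
    ∀ i' ∈ Set.Icc 1 l, totalCost β z l r x i j ≤ totalCost β z l r x i' j}

/-- `(i, j)` is a possible choice of `(l*, r*)`: `D(i, j)` is the optimal value of the original
instance with all `n` sensors at their input locations. -/
def IsOptimalPair (β z : ℝ) (n l r : ℕ) (x : ℕ → ℝ) (i j : ℕ) : Prop :=
  i ∈ Set.Icc 1 l ∧ j ∈ Set.Icc r n ∧
    totalCost β z l r x i j = ((minSum β z (Finset.Icc 1 n) x : ℝ) : EReal)

end BarrierCoverage

namespace BarrierCoverage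

/-! ### Order-preserving relocations -/

/-! On its finite values `D` is modular: D(i,j') + D(i',j) = D(i,j) + D(i',j')
(`finiteCost_add_eq`). Hence D(i,j) - D(i,j') does not depend on i as long as the values are finite.
Since D_opt bounds `D` from below (`minSum_le_finiteCost`), r* minimizes D(l*,·). If |S_I| ≥ λ, all
values are finite and statement 1 follows.

For modularity, relocations may be taken sorted and clamped to [-z, β+z]; covering then makes u_t =
y_t - 2zt antitone with one bound at each end (`exists_chain_le`). A level c splits each cost |u_t -
a_t| into a part above c and a part below c. For a suitable c, the upper part of one chain fits the
lower part of another, so two chains exchange their right ends without extra cost. Exchanging in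
both directions gives equality.

In statement 2, S(l*,j) may be too small for modularity to compare j with r*. Then m = l* + λ - 1
satisfies j < m < r*; modularity gives D(i,r*) ≤ D(i,m), and convexity of D(i,·)
(`finiteCost_midpoint_le`) gives D(i,m) ≤ D(i,j). -/

lemma abs_sub_add_abs_sub_le_of_le {p q a b : ℝ} (hpq : p ≤ q) (hab : a ≤ b) :
    |p - a| + |q - b| ≤ |p - b| + |q - a| := by
  rcases abs_cases (p - a) with h1 | h1 <;> rcases abs_cases (q - b) with h2 | h2 <;>
  rcases abs_cases (p - b) with h3 | h3 <;> rcases abs_cases (q - a) with h4 | h4 <;> linarith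

lemma sum_abs_sub_comp_swap_le {k : ℕ} {X g : Fin k → ℝ} (hX : Monotone X) {p q : Fin k}
    (hpq : p < q) (hg : g q < g p) :
    ∑ t, |X t - (g ∘ Equiv.swap p q) t| ≤ ∑ t, |X t - g t| := by
  rw [← sub_nonneg, ← Finset.sum_sub_distrib, Fintype.sum_eq_add p q hpq.ne]
  · have := abs_sub_add_abs_sub_le_of_le (hX hpq.le) hg.le
    simp only [Function.comp, Equiv.swap_apply_left, Equiv.swap_apply_right]
    linarith
  · rintro t ⟨h1, h2⟩
    simp [Equiv.swap_apply_of_ne_of_ne h1 h2]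

/-- Sorting the targets never increases the total moving distance. -/
lemma sum_abs_sub_comp_sort_le {k : ℕ} {X f : Fin k → ℝ} (hX : Monotone X) :
    ∑ t, |X t - (f ∘ Tuple.sort f) t| ≤ ∑ t, |X t - f t| :=
  Tuple.bubble_sort_induction (P := fun g => ∑ t, |X t - g t| ≤ ∑ t, |X t - f t|) le_rfl
    fun _ _ _ hpq hg hP => (sum_abs_sub_comp_swap_le hX hpq hg).trans hP

lemma moveCost_Icc (i j : ℕ) (x y : ℕ → ℝ) :
    moveCost (Finset.Icc i j) x y = ∑ t : Fin (j + 1 - i), |x (i + t) - y (i + t)| := by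
  have : Finset.Icc i j = Finset.Ico i (j + 1) := by ext; simp
  rw [moveCost, this, Finset.sum_Ico_eq_sum_range, Finset.sum_range]

lemma covers_iff {β z : ℝ} {T : Finset ℕ} {y : ℕ → ℝ} :
    Covers β z T y ↔ ∀ p, 0 ≤ p → p ≤ β → ∃ t ∈ T, y t - z ≤ p ∧ p ≤ y t + z := by
  simp only [Covers, coverInterval, Set.subset_def, Set.mem_Icc, Set.mem_iUnion,
    exists_prop, and_imp]

/-- All ranges are equal, so permuting the target locations among the sensors preserves coverage. -/
lemma exists_monotoneOn_covers {β z : ℝ} {i j : ℕ} {x y : ℕ → ℝ}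
    (hx : MonotoneOn x (Set.Icc i j)) (hy : Covers β z (Finset.Icc i j) y) :
    ∃ y' : ℕ → ℝ, MonotoneOn y' (Set.Icc i j) ∧ Covers β z (Finset.Icc i j) y' ∧
      moveCost (Finset.Icc i j) x y' ≤ moveCost (Finset.Icc i j) x y := by
  set f : Fin (j + 1 - i) → ℝ := fun t => y (i + t) with hf
  have hmono := Tuple.monotone_sort f
  -- Only values on `[i, j]` matter; there `t - i` is not truncated and `y'` lists the sorted
  -- targets.
  let y' : ℕ → ℝ := fun t => if h : t - i < j + 1 - i then (f ∘ Tuple.sort f) ⟨t - i, h⟩ else 0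
  have hy' : ∀ t : Fin (j + 1 - i), y' (i + t) = (f ∘ Tuple.sort f) t := by
    intro t
    have : i + (t : ℕ) - i < j + 1 - i := by omega
    simp only [y', dif_pos this]
    congr 1
    ext
    simp
  refine ⟨y', ?_, ?_, ?_⟩
  · intro s hs t ht hst
    have h1 : s - i < j + 1 - i := by have := hs.1; have := hs.2; omega
    have h2 : t - i < j + 1 - i := by have := ht.1; have := ht.2; omega
    simp only [y', dif_pos h1, dif_pos h2]
    exact hmono (Fin.mk_le_mk.2 (by omega))
  · rw [covers_iff] at hy ⊢
    intro p h0 hp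
    obtain ⟨t, ht, h⟩ := hy p h0 hp
    rw [Finset.mem_Icc] at ht
    let k : Fin (j + 1 - i) := ⟨t - i, by omega⟩
    have hk : y' (i + ((Tuple.sort f).symm k : Fin _)) = y t := by
      rw [hy']
      simp only [Function.comp, Equiv.apply_symm_apply, hf, k]
      congr 1
      omega
    refine ⟨i + ((Tuple.sort f).symm k : Fin _), ?_, by rwa [hk]⟩
    have := ((Tuple.sort f).symm k).2
    rw [Finset.mem_Icc]
    omega
  · rw [moveCost_Icc, moveCost_Icc]
    simp only [hy']
    refine sum_abs_sub_comp_sort_le (X := fun t : Fin (j + 1 - i) => x (i + t)) ?_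
    intro s t hst
    have : (s : ℕ) ≤ t := hst
    exact hx ⟨by omega, by omega⟩ ⟨by omega, by omega⟩ (by omega)

/-! ### Chains -/

/-- `u t = y t - 2 * z * t` for relocations `y` of `s_i, …, s_j` in which consecutive covering
intervals leave no gap, the first one starts at or before `0` and the last one ends at or
after `β`. -/
structure IsChain (β z : ℝ) (i j : ℕ) (u : ℕ → ℝ) : Prop where
  antitone : AntitoneOn u (Set.Icc i j)
  first_le : u i ≤ z - 2 * z * i
  le_last : β - z - 2 * z * j ≤ u j

/-- Cost of the chain `u` when the sensors initially are at `x`. -/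
def chainCost (z : ℝ) (x : ℕ → ℝ) (i j : ℕ) (u : ℕ → ℝ) : ℝ :=
  ∑ t ∈ Finset.Icc i j, |u t - (x t - 2 * z * t)|

lemma IsChain.covers {β z : ℝ} {i j : ℕ} {u : ℕ → ℝ} (hij : i ≤ j) (hu : IsChain β z i j u) :
    Covers β z (Finset.Icc i j) (fun t => u t + 2 * z * t) := by
  classical
  rw [covers_iff]
  intro p h0 hp
  -- The first sensor whose right end reaches `p` covers `p`: its predecessor stops short of `p` and
  -- consecutive intervals leave no gap.
  have hex : ∃ t, i ≤ t ∧ p ≤ u t + 2 * z * t + z := ⟨j, hij, by linarith [hu.le_last]⟩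
  obtain ⟨hit, hpt⟩ := Nat.find_spec hex
  have hmin := fun m => Nat.find_min (m := m) hex
  have htj : Nat.find hex ≤ j := Nat.find_min' hex ⟨hij, by linarith [hu.le_last]⟩
  generalize Nat.find hex = t at *
  refine ⟨t, Finset.mem_Icc.2 ⟨hit, htj⟩, ?_, hpt⟩
  rcases hit.eq_or_lt with rfl | h
  · linarith [hu.first_le]
  · obtain ⟨s, rfl⟩ : ∃ s, t = s + 1 := ⟨t - 1, by omega⟩
    have h1 := hmin s (by omega)
    have h2 : p > u s + 2 * z * s + z := by
      by_contra hc
      exact h1 ⟨by omega, not_lt.1 hc⟩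
    have h3 := hu.antitone (a := s) ⟨by omega, by omega⟩ (b := s + 1) ⟨by omega, by omega⟩
      (by omega)
    push_cast
    linarith

lemma moveCost_chain (z : ℝ) (x : ℕ → ℝ) (i j : ℕ) (u : ℕ → ℝ) :
    moveCost (Finset.Icc i j) x (fun t => u t + 2 * z * t) = chainCost z x i j u := by
  refine Finset.sum_congr rfl fun t _ => ?_
  rw [abs_sub_comm]
  congr 1
  ring

/-- Clamping sorted targets to [-z, β+z] keeps the coverage and, as the initial locations lie there,
does not raise the cost. It also forces any gap between neighbours to lie inside the barrier. -/
lemma exists_chain_le {β z : ℝ} (hz : 0 < z) (hβ : 0 < β) {i j : ℕ} {x y : ℕ → ℝ}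
    (hx : MonotoneOn x (Set.Icc i j)) (hxm : ∀ t ∈ Set.Icc i j, x t ∈ Set.Icc (-z) (β + z))
    (hy : Covers β z (Finset.Icc i j) y) :
    ∃ u, IsChain β z i j u ∧ chainCost z x i j u ≤ moveCost (Finset.Icc i j) x y := by
  obtain ⟨y₁, hm, hc, hle⟩ := exists_monotoneOn_covers hx hy
  rw [covers_iff] at hc
  set w : ℕ → ℝ := fun t => max (-z) (min (y₁ t) (β + z)) with hw
  have hwm : MonotoneOn w (Set.Icc i j) := fun s hs t ht hst =>
    max_le_max le_rfl (min_le_min (hm hs ht hst) le_rfl)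
  have hwc : ∀ p, 0 ≤ p → p ≤ β → ∃ t ∈ Finset.Icc i j, w t - z ≤ p ∧ p ≤ w t + z := by
    intro p h0 hp
    obtain ⟨t, ht, h1, h2⟩ := hc p h0 hp
    refine ⟨t, ht, ?_, ?_⟩
    · have : w t ≤ p + z := max_le (by linarith) ((min_le_left _ _).trans (by linarith))
      linarith
    · have : p - z ≤ w t := le_max_of_le_right (le_min (by linarith) (by linarith))
      linarith
  refine ⟨fun t => w t - 2 * z * t, ⟨?_, ?_, ?_⟩, ?_⟩
  · refine antitoneOn_of_succ_le Set.ordConnected_Icc ?_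
    intro t _ ht ht'
    rw [Nat.succ_eq_succ] at ht' ⊢
    by_contra hcon
    push Not at hcon
    push_cast at hcon
    have hb1 : -z ≤ w t := le_max_left _ _
    have hb2 : w (t + 1) ≤ β + z := max_le (by linarith) (min_le_right _ _)
    -- Neighbours more than 2z apart would leave their midpoint uncovered; clamping puts it in [0,
    -- β].
    obtain ⟨s, hs, h1, h2⟩ := hwc ((w t + w (t + 1)) / 2) (by linarith) (by linarith)
    rw [Finset.mem_Icc] at hs
    rcases le_or_gt s t with h | h
    · have := hwm (a := s) hs (b := t) ht h
      linarith
    · have := hwm (a := t + 1) ht' (b := s) hs h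
      linarith
  · obtain ⟨s, hs, h1, -⟩ := hwc 0 le_rfl hβ.le
    rw [Finset.mem_Icc] at hs
    have := hwm (a := i) ⟨le_rfl, hs.1.trans hs.2⟩ hs hs.1
    linarith
  · obtain ⟨s, hs, -, h1⟩ := hwc β hβ.le le_rfl
    rw [Finset.mem_Icc] at hs
    have := hwm hs (b := j) ⟨hs.1.trans hs.2, le_rfl⟩ hs.2
    linarith
  · refine le_trans ?_ hle
    rw [← moveCost_chain]
    refine Finset.sum_le_sum fun t ht => ?_
    rw [Finset.mem_Icc] at ht
    obtain ⟨hx1, hx2⟩ := hxm t ht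
    have e : x t = max (-z) (min (x t) (β + z)) := by rw [min_eq_left hx2, max_eq_right hx1]
    have : |x t - w t| ≤ |x t - y₁ t| := by
      conv_lhs => rw [e]
      rw [hw]
      refine (abs_max_sub_max_le_max _ _ _ _).trans (max_le (by simp) ?_)
      exact (abs_min_sub_min_le_max _ _ _ _).trans (max_le le_rfl (by simp))
    simpa using this

lemma bddBelow_moveCosts (β z : ℝ) (T : Finset ℕ) (x : ℕ → ℝ) :
    BddBelow {c | ∃ y : ℕ → ℝ, Covers β z T y ∧ c = moveCost T x y} := by
  refine ⟨0, ?_⟩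
  rintro c ⟨y, -, rfl⟩
  exact Finset.sum_nonneg fun _ _ => abs_nonneg _

lemma minSum_le_moveCost {β z : ℝ} {T : Finset ℕ} {x y : ℕ → ℝ} (hy : Covers β z T y) :
    minSum β z T x ≤ moveCost T x y :=
  csInf_le (bddBelow_moveCosts β z T x) ⟨y, hy, rfl⟩

lemma minSum_le_chainCost {β z : ℝ} {i j : ℕ} (hij : i ≤ j) {x u : ℕ → ℝ}
    (hu : IsChain β z i j u) : minSum β z (Finset.Icc i j) x ≤ chainCost z x i j u := by
  rw [← moveCost_chain]
  exact minSum_le_moveCost (hu.covers hij)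

lemma exists_isChain {β z : ℝ} {i j : ℕ}
    (h : β - z - 2 * z * j ≤ z - 2 * z * i) : ∃ u, IsChain β z i j u :=
  ⟨fun _ => z - 2 * z * i, fun _ _ _ _ _ => le_rfl, le_rfl, h⟩

lemma le_minSum {β z : ℝ} (hz : 0 < z) (hβ : 0 < β) {i j : ℕ} (hij : i ≤ j) {x : ℕ → ℝ}
    (hx : MonotoneOn x (Set.Icc i j)) (hxm : ∀ t ∈ Set.Icc i j, x t ∈ Set.Icc (-z) (β + z))
    (h : β - z - 2 * z * j ≤ z - 2 * z * i) {b : ℝ}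
    (hb : ∀ u, IsChain β z i j u → b ≤ chainCost z x i j u) :
    b ≤ minSum β z (Finset.Icc i j) x := by
  refine le_csInf ?_ ?_
  · obtain ⟨u, hu⟩ := exists_isChain h
    exact ⟨_, _, hu.covers hij, rfl⟩
  · rintro c ⟨y, hy, rfl⟩
    obtain ⟨u, hu, hle⟩ := exists_chain_le hz hβ hx hxm hy
    exact (hb u hu).trans hle

/-! ### Recombining chains -/

/-- The level `c` cuts the segment between `p` and `a` into a piece above and a piece below, and
lengths add. -/
lemma abs_sub_eq_max_add_min (p a c : ℝ) :
    |p - a| = |max p c - max a c| + |min p c - min a c| := by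
  rcases le_total p c with h1 | h1 <;> rcases le_total a c with h2 | h2 <;>
    simp only [max_eq_left, max_eq_right, min_eq_left, min_eq_right, h1, h2, sub_self, abs_zero,
      zero_add, add_zero]
  · rw [abs_of_nonpos (by linarith), abs_of_nonpos (by linarith), abs_of_nonpos (by linarith)]
    ring
  · rw [abs_of_nonneg (by linarith), abs_of_nonneg (by linarith), abs_of_nonneg (by linarith)]
    ring

lemma abs_splice_sub_le (p q a c : ℝ) :
    |max p c + min q c - c - a| ≤ |max p c - max a c| + |min q c - min a c| := by
  have h : max p c + min q c - c - a = (max p c - max a c) + (min q c - min a c) := by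
    linarith [max_add_min a c]
  rw [h]
  exact abs_add_le _ _

/-- The chain `u` on `[i, j]`, continued by the initial locations. -/
noncomputable def extend (z : ℝ) (x : ℕ → ℝ) (i j : ℕ) (u : ℕ → ℝ) (t : ℕ) : ℝ :=
  if t ∈ Finset.Icc i j then u t else x t - 2 * z * t

lemma extend_of_mem {z : ℝ} {x : ℕ → ℝ} {i j : ℕ} {u : ℕ → ℝ} {t : ℕ} (h1 : i ≤ t) (h2 : t ≤ j) :
    extend z x i j u t = u t := if_pos (Finset.mem_Icc.2 ⟨h1, h2⟩)

lemma extend_of_lt {z : ℝ} {x : ℕ → ℝ} {i j : ℕ} {u : ℕ → ℝ} {t : ℕ} (h : t < i) :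
    extend z x i j u t = x t - 2 * z * t :=
  if_neg fun h' => h.not_ge (Finset.mem_Icc.1 h').1

lemma extend_of_gt {z : ℝ} {x : ℕ → ℝ} {i j : ℕ} {u : ℕ → ℝ} {t : ℕ} (h : j < t) :
    extend z x i j u t = x t - 2 * z * t :=
  if_neg fun h' => h.not_ge (Finset.mem_Icc.1 h').2

lemma chainCost_eq_sum_extend (z : ℝ) (x : ℕ → ℝ) (i : ℕ) {j N : ℕ} (hN : j < N) (u : ℕ → ℝ) :
    chainCost z x i j u = ∑ t ∈ Finset.range N, |extend z x i j u t - (x t - 2 * z * t)| := by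
  rw [chainCost, ← Finset.sum_subset (s₁ := Finset.Icc i j) (s₂ := Finset.range N)]
  · refine Finset.sum_congr rfl fun t ht => ?_
    rw [extend, if_pos ht]
  · intro t ht
    rw [Finset.mem_Icc] at ht
    rw [Finset.mem_range]
    omega
  · intro t _ ht
    rw [extend, if_neg ht, sub_self, abs_zero]

/-- Above the level `c` the chain `u` on `[i, j]`, below it the chain `v` on `[i', j']`. -/
noncomputable def splice (z : ℝ) (x : ℕ → ℝ) (c : ℝ) (i j i' j' : ℕ) (u v : ℕ → ℝ) (t : ℕ) : ℝ :=
  max (extend z x i j u t) c + min (extend z x i' j' v t) c - c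

/-- The upper part of `u` is constantly `c` beyond `j` by `hR`, and the lower part of `v` is
constantly `c` before `i'` by `hL`. So both stay antitone on all of `[i, j']`; `u` supplies the
bound at `i` and `v` the one at `j'`. -/
lemma IsChain.splice {β z c : ℝ} {x : ℕ → ℝ} {i j i' j' : ℕ} {u v : ℕ → ℝ}
    (hij : i ≤ j) (hij' : i' ≤ j') (hu : IsChain β z i j u) (hv : IsChain β z i' j' v)
    (hL : ∀ t < i', c ≤ x t - 2 * z * t) (hR : ∀ t, j < t → x t - 2 * z * t ≤ c)
    (hci : c ≤ z - 2 * z * i) (hcj : β - z - 2 * z * j' ≤ c) :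
    IsChain β z i j' (BarrierCoverage.splice z x c i j i' j' u v) := by
  refine ⟨?_, ?_, ?_⟩
  · intro s hs t ht hst
    have h1 : max (extend z x i j u t) c ≤ max (extend z x i j u s) c := by
      rcases le_or_gt t j with h | h
      · rw [extend_of_mem ht.1 h, extend_of_mem hs.1 (hst.trans h)]
        exact max_le_max (hu.antitone ⟨hs.1, hst.trans h⟩ ⟨ht.1, h⟩ hst) le_rfl
      · rw [extend_of_gt h, max_eq_right (hR t h)]
        exact le_max_right _ _
    have h2 : min (extend z x i' j' v t) c ≤ min (extend z x i' j' v s) c := by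
      rcases le_or_gt i' s with h | h
      · rw [extend_of_mem h hs.2, extend_of_mem (h.trans hst) ht.2]
        exact min_le_min (hv.antitone ⟨h, hs.2⟩ ⟨h.trans hst, ht.2⟩ hst) le_rfl
      · rw [extend_of_lt h, min_eq_right (hL s h)]
        exact min_le_right _ _
    simp only [BarrierCoverage.splice]
    linarith
  · have h1 : max (extend z x i j u i) c ≤ z - 2 * z * i := by
      rw [extend_of_mem le_rfl hij]
      exact max_le hu.first_le hci
    have h2 : min (extend z x i' j' v i) c ≤ c := min_le_right _ _
    simp only [BarrierCoverage.splice]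
    linarith
  · have h1 : c ≤ max (extend z x i j u j') c := le_max_right _ _
    have h2 : β - z - 2 * z * j' ≤ min (extend z x i' j' v j') c := by
      rw [extend_of_mem hij' le_rfl]
      exact le_min hv.le_last hcj
    simp only [BarrierCoverage.splice]
    linarith

lemma chainCost_splice_le {z c : ℝ} {x : ℕ → ℝ} {i j i' j' N : ℕ} {u v : ℕ → ℝ} (hN : j' < N) :
    chainCost z x i j' (splice z x c i j i' j' u v) ≤
      ∑ t ∈ Finset.range N,
        (|max (extend z x i j u t) c - max (x t - 2 * z * t) c| +
          |min (extend z x i' j' v t) c - min (x t - 2 * z * t) c|) := by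
  rw [chainCost]
  refine (Finset.sum_le_sum fun t _ => abs_splice_sub_le _ _ _ _).trans ?_
  refine Finset.sum_le_sum_of_subset_of_nonneg ?_ fun _ _ _ => by positivity
  intro t ht
  rw [Finset.mem_Icc] at ht
  rw [Finset.mem_range]
  omega

/-- The two splices together use each upper and each lower part of `u` and `v` once. -/
lemma chainCost_splice_add_le {z c : ℝ} {x : ℕ → ℝ} {i j i' j' : ℕ} {u v : ℕ → ℝ} :
    chainCost z x i j' (splice z x c i j i' j' u v) +
        chainCost z x i' j (splice z x c i' j' i j v u) ≤
      chainCost z x i j u + chainCost z x i' j' v := by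
  have hj : j < max j j' + 1 := by omega
  have hj' : j' < max j j' + 1 := by omega
  refine (add_le_add (chainCost_splice_le hj') (chainCost_splice_le hj)).trans ?_
  rw [chainCost_eq_sum_extend z x i hj, chainCost_eq_sum_extend z x i' hj',
    ← Finset.sum_add_distrib, ← Finset.sum_add_distrib]
  refine Finset.sum_le_sum fun t _ => ?_
  rw [abs_sub_eq_max_add_min (extend z x i j u t) _ c,
    abs_sub_eq_max_add_min (extend z x i' j' v t) _ c]
  linarith

/-- If v ≤ d, the new values d and u + v - d lie between v and u and have the same sum, so convexity
of |· - a| applies; otherwise nothing changes. -/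
lemma abs_max_sub_add_abs_sub_le {u v a d e : ℝ} (hu : d + e ≤ u) (hv : d - e ≤ v) (he : 0 ≤ e) :
    |max v d - a| + |u + min v d - d - a| ≤ |u - a| + |v - a| := by
  rcases le_total v d with h | h
  · rw [max_eq_right h, min_eq_left h]
    rcases abs_cases (d - a) with h1 | h1 <;> rcases abs_cases (u + v - d - a) with h2 | h2 <;>
    rcases abs_cases (u - a) with h3 | h3 <;> rcases abs_cases (v - a) with h4 | h4 <;> linarith
  · rw [max_eq_left h, min_eq_right h, add_sub_cancel_right]
    linarith

/-- Chains on `[i, m]` and `[i, m + 2]` can be turned into two chains on `[i, m + 1]`. -/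
lemma exists_isChain_midpoint {β z : ℝ} (hz : 0 < z) {x : ℕ → ℝ} {i m : ℕ} (him : i ≤ m)
    {u v : ℕ → ℝ} (hu : IsChain β z i m u) (hv : IsChain β z i (m + 2) v)
    (hxm : x (m + 1) = β + z) (h : β - z - 2 * z * m ≤ z - 2 * z * i) :
    ∃ w w', IsChain β z i (m + 1) w ∧ IsChain β z i (m + 1) w' ∧
      chainCost z x i (m + 1) w + chainCost z x i (m + 1) w' ≤
        chainCost z x i m u + chainCost z x i (m + 2) v := by
  -- `d` is the least value a chain ending at `m + 1` may take there.
  obtain ⟨d, hd⟩ : ∃ d, d = β - z - 2 * z * (m + 1) := ⟨_, rfl⟩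
  have hue : ∀ t ∈ Set.Icc i (m + 1), d + 2 * z ≤ extend z x i m u t := by
    intro t ht
    rcases le_or_gt t m with h1 | h1
    · rw [extend_of_mem ht.1 h1]
      have := hu.antitone ⟨ht.1, h1⟩ ⟨him, le_rfl⟩ h1
      linarith [hu.le_last]
    · obtain rfl : t = m + 1 := le_antisymm ht.2 h1
      rw [extend_of_gt h1, hxm]
      push_cast
      linarith
  have hvl := hv.le_last
  push_cast at hvl
  have hve : ∀ t ∈ Set.Icc i (m + 2), d - 2 * z ≤ v t := by
    intro t ht
    have := hv.antitone ht ⟨by omega, le_rfl⟩ ht.2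
    linarith
  -- `v` is raised to `d` and its deficit is charged to `u`. The deficit is at most 2z, and the
  -- extended `u` has exactly that much to spare at `m + 1`.
  refine ⟨fun t => max (v t) d, fun t => extend z x i m u t + min (v t) d - d,
    ⟨?_, ?_, ?_⟩, ⟨?_, ?_, ?_⟩, ?_⟩
  · intro s hs t ht hst
    exact max_le_max (hv.antitone ⟨hs.1, by have := hs.2; omega⟩ ⟨ht.1, by have := ht.2; omega⟩ hst)
      le_rfl
  · exact max_le hv.first_le (by linarith)
  · push_cast
    rw [← hd]
    exact le_max_right _ _
  · intro s hs t ht hst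
    have h1 : extend z x i m u t ≤ extend z x i m u s := by
      rcases le_or_gt t m with h1 | h1
      · rw [extend_of_mem ht.1 h1, extend_of_mem hs.1 (hst.trans h1)]
        exact hu.antitone ⟨hs.1, hst.trans h1⟩ ⟨ht.1, h1⟩ hst
      · obtain rfl : t = m + 1 := le_antisymm ht.2 h1
        have : extend z x i m u (m + 1) = d + 2 * z := by
          rw [extend_of_gt h1, hxm, hd]
          push_cast
          ring
        rw [this]
        exact hue s hs
    have h2 : min (v t) d ≤ min (v s) d := min_le_min
      (hv.antitone ⟨hs.1, by have := hs.2; omega⟩ ⟨ht.1, by have := ht.2; omega⟩ hst) le_rfl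
    dsimp only
    linarith
  · have := min_le_right (v i) d
    rw [extend_of_mem le_rfl him]
    linarith [hu.first_le]
  · have h1 := hue (m + 1) ⟨by omega, le_rfl⟩
    have h2 : d - 2 * z ≤ min (v (m + 1)) d :=
      le_min (hve _ ⟨by omega, by omega⟩) (by linarith)
    push_cast
    linarith
  · have h1 : ∑ t ∈ Finset.Icc i (m + 1), |extend z x i m u t - (x t - 2 * z * t)| =
        chainCost z x i m u := by
      rw [← Finset.insert_Icc_right_eq_Icc_add_one (by omega),
        Finset.sum_insert (by simp), extend_of_gt (by omega), sub_self, abs_zero, zero_add]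
      refine Finset.sum_congr rfl fun t ht => ?_
      rw [extend, if_pos ht]
    have h2 : ∑ t ∈ Finset.Icc i (m + 1), |v t - (x t - 2 * z * t)| ≤
        chainCost z x i (m + 2) v :=
      Finset.sum_le_sum_of_subset_of_nonneg (Finset.Icc_subset_Icc_right (by omega))
        fun _ _ _ => abs_nonneg _
    rw [← h1]
    refine le_trans ?_ (add_le_add le_rfl h2)
    rw [chainCost, chainCost, ← Finset.sum_add_distrib, ← Finset.sum_add_distrib]
    refine Finset.sum_le_sum fun t ht => ?_
    rw [Finset.mem_Icc] at ht
    exact abs_max_sub_add_abs_sub_le (hue t ht) (hve t ⟨ht.1, by omega⟩) (by linarith)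

/-! ### The costs `D(i, j)` -/

/-- The right-hand side says that the two end bounds of a chain are compatible. -/
lemma minSensors_le_card_iff {β z : ℝ} (hz : 0 < z) {i j : ℕ} (hij : i ≤ j) :
    minSensors β z ≤ (Finset.Icc i j).card ↔ β - z - 2 * z * j ≤ z - 2 * z * i := by
  rw [minSensors, Nat.ceil_le, Nat.card_Icc, div_le_iff₀ (by positivity),
    Nat.cast_sub (by omega)]
  push_cast
  constructor <;> intro h <;> linarith

lemma mem_meeting_iff {β z : ℝ} (hz : 0 < z) (hβ : 0 < β) {n t : ℕ} {x : ℕ → ℝ} :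
    t ∈ meeting β z n x ↔ t ∈ Set.Icc 1 n ∧ x t ∈ Set.Icc (-z) (β + z) := by
  have : (coverInterval z (x t) ∩ Set.Icc 0 β).Nonempty ↔ x t ∈ Set.Icc (-z) (β + z) := by
    rw [coverInterval, Set.Icc_inter_Icc, Set.nonempty_Icc]
    simp only [sup_le_iff, le_inf_iff, Set.mem_Icc]
    constructor
    · rintro ⟨⟨-, h1⟩, h2, -⟩
      constructor <;> linarith
    · rintro ⟨h1, h2⟩
      refine ⟨⟨?_, ?_⟩, ?_, ?_⟩ <;> linarith
  rw [← this]
  rfl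

/-- A sorted instance in which exactly `s_l, …, s_r` have covering intervals that may meet the
barrier. -/
structure IsSorted (β z : ℝ) (n l r : ℕ) (x : ℕ → ℝ) : Prop where
  z_pos : 0 < z
  β_pos : 0 < β
  mono : MonotoneOn x (Set.Icc 1 n)
  one_le : 1 ≤ l
  le : l ≤ r
  le_n : r ≤ n
  left : ∀ t, 1 ≤ t → t < l → x t ≤ -z
  mid : ∀ t, l ≤ t → t ≤ r → x t ∈ Set.Icc (-z) (β + z)
  right : ∀ t, r < t → t ≤ n → β + z ≤ x t

lemma isSorted_of_meeting {β z : ℝ} {n l r : ℕ} {x : ℕ → ℝ} (hz : 0 < z) (hβ : 0 < β)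
    (hx : MonotoneOn x (Set.Icc 1 n)) (hl : IsLeast (meeting β z n x) l)
    (hr : IsGreatest (meeting β z n x) r) : IsSorted β z n l r x := by
  obtain ⟨hl1, hl2⟩ := (mem_meeting_iff hz hβ).1 hl.1
  obtain ⟨hr1, hr2⟩ := (mem_meeting_iff hz hβ).1 hr.1
  refine ⟨hz, hβ, hx, hl1.1, hl.2 hr.1, hr1.2, ?_, ?_, ?_⟩
  · intro t h1 h2
    by_contra hcon
    have ht : t ∈ Set.Icc 1 n := ⟨h1, h2.le.trans hl1.2⟩
    have := hl.2 ((mem_meeting_iff hz hβ).2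
      ⟨ht, (not_le.1 hcon).le, (hx ht hl1 h2.le).trans hl2.2⟩)
    omega
  · intro t h1 h2
    have ht : t ∈ Set.Icc 1 n := ⟨hl1.1.trans h1, h2.trans hr1.2⟩
    exact ⟨hl2.1.trans (hx hl1 ht h1), (hx ht hr1 h2).trans hr2.2⟩
  · intro t h1 h2
    by_contra hcon
    have ht : t ∈ Set.Icc 1 n := ⟨hr1.1.trans h1.le, h2⟩
    have := hr.2 ((mem_meeting_iff hz hβ).2
      ⟨ht, hr2.1.trans (hx hr1 ht h1.le), (not_le.1 hcon).le⟩)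
    omega

/-- The finite value of `D(i, j)`. -/
noncomputable def finiteCost (β z : ℝ) (l r : ℕ) (x : ℕ → ℝ) (i j : ℕ) : ℝ :=
  containCost β z l r x i j + (costLeft z l x i + costRight β z r x j)

lemma totalCost_of_le {β z : ℝ} {l r : ℕ} {x : ℕ → ℝ} {i j : ℕ}
    (h : minSensors β z ≤ (Finset.Icc i j).card) :
    totalCost β z l r x i j = (finiteCost β z l r x i j : EReal) := if_neg h.not_gt

lemma totalCost_of_lt {β z : ℝ} {l r : ℕ} {x : ℕ → ℝ} {i j : ℕ}
    (h : (Finset.Icc i j).card < minSensors β z) : totalCost β z l r x i j = ⊤ := if_pos h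

lemma manualMove_of_lt {β z : ℝ} {l r t : ℕ} {x : ℕ → ℝ} (h : t < l) :
    manualMove β z l r x t = -z := if_pos h

lemma manualMove_of_gt {β z : ℝ} {l r t : ℕ} {x : ℕ → ℝ} (hlr : l ≤ r) (h : r < t) :
    manualMove β z l r x t = β + z := by
  rw [manualMove, if_neg (by omega), if_pos h]

lemma manualMove_of_mem {β z : ℝ} {l r t : ℕ} {x : ℕ → ℝ} (h1 : l ≤ t) (h2 : t ≤ r) :
    manualMove β z l r x t = x t := by
  rw [manualMove, if_neg (by omega), if_neg (by omega)]

namespace IsSorted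

variable {β z : ℝ} {n l r : ℕ} {x : ℕ → ℝ}

lemma manualMove_mem (h : IsSorted β z n l r x) (t : ℕ) :
    manualMove β z l r x t ∈ Set.Icc (-z) (β + z) := by
  have hz := h.z_pos
  have hβ := h.β_pos
  rcases lt_or_ge t l with h1 | h1
  · rw [manualMove_of_lt h1]
    exact ⟨le_rfl, by linarith⟩
  rcases lt_or_ge r t with h2 | h2
  · rw [manualMove_of_gt h.le h2]
    exact ⟨by linarith, le_rfl⟩
  rw [manualMove_of_mem h1 h2]
  exact h.mid t h1 h2

lemma monotone_manualMove (h : IsSorted β z n l r x) : Monotone (manualMove β z l r x) := by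
  intro s t hst
  rcases lt_or_ge s l with h1 | h1
  · rw [manualMove_of_lt h1]
    exact (h.manualMove_mem t).1
  rcases lt_or_ge r t with h2 | h2
  · rw [manualMove_of_gt h.le h2]
    exact (h.manualMove_mem s).2
  rw [manualMove_of_mem h1 (hst.trans h2), manualMove_of_mem (h1.trans hst) h2]
  exact h.mono ⟨h.one_le.trans h1, (hst.trans h2).trans h.le_n⟩
    ⟨(h.one_le.trans h1).trans hst, h2.trans h.le_n⟩ hst

lemma le_containCost (h : IsSorted β z n l r x) {i j : ℕ} (hi : i ≤ l) (hj : r ≤ j)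
    (hf : minSensors β z ≤ (Finset.Icc i j).card) {b : ℝ}
    (hb : ∀ u, IsChain β z i j u → b ≤ chainCost z (manualMove β z l r x) i j u) :
    b ≤ containCost β z l r x i j := by
  have hij : i ≤ j := hi.trans (h.le.trans hj)
  exact le_minSum h.z_pos h.β_pos hij (h.monotone_manualMove.monotoneOn _)
    (fun t _ => h.manualMove_mem t) ((minSensors_le_card_iff h.z_pos hij).1 hf) hb

lemma containCost_add_le (h : IsSorted β z n l r x) {i j i' j' : ℕ} (hi : i ≤ l) (hj : r ≤ j)
    (hi' : i' ≤ l) (hj' : r ≤ j')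
    (h1 : minSensors β z ≤ (Finset.Icc i j).card) (h2 : minSensors β z ≤ (Finset.Icc i' j').card)
    (h3 : minSensors β z ≤ (Finset.Icc i j').card) (h4 : minSensors β z ≤ (Finset.Icc i' j).card) :
    containCost β z l r x i j' + containCost β z l r x i' j ≤
      containCost β z l r x i j + containCost β z l r x i' j' := by
  have hz := h.z_pos
  have hlr := h.le
  have e1 := (minSensors_le_card_iff hz (by omega)).1 h1
  have e2 := (minSensors_le_card_iff hz (by omega)).1 h2
  have e3 := (minSensors_le_card_iff hz (by omega)).1 h3
  have e4 := (minSensors_le_card_iff hz (by omega)).1 h4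
  -- A common level separates both right-end bounds from both left-end bounds precisely because all
  -- four sensor sets are large enough.
  obtain ⟨c, hcj, hcj', hci, hci'⟩ : ∃ c, β - z - 2 * z * j ≤ c ∧ β - z - 2 * z * j' ≤ c ∧
      c ≤ z - 2 * z * i ∧ c ≤ z - 2 * z * i' :=
    ⟨max (β - z - 2 * z * j) (β - z - 2 * z * j'), le_max_left _ _, le_max_right _ _,
      max_le e1 e3, max_le e4 e2⟩
  have hL : ∀ k ≤ l, c ≤ z - 2 * z * k → ∀ t < k, c ≤ manualMove β z l r x t - 2 * z * t := by
    intro k hk hc t ht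
    rw [manualMove_of_lt (ht.trans_le hk)]
    have : (t : ℝ) + 1 ≤ k := by exact_mod_cast ht
    nlinarith
  have hR : ∀ k, r ≤ k → β - z - 2 * z * k ≤ c → ∀ t, k < t →
      manualMove β z l r x t - 2 * z * t ≤ c := by
    intro k hk hc t ht
    rw [manualMove_of_gt hlr (hk.trans_lt ht)]
    have : (k : ℝ) + 1 ≤ t := by exact_mod_cast ht
    nlinarith
  -- The two infima on the right are replaced by arbitrary chains one at a time, so no minimizer is
  -- needed.
  rw [← sub_le_iff_le_add]
  refine h.le_containCost hi hj h1 fun u hu => ?_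
  rw [sub_le_comm]
  refine h.le_containCost hi' hj' h2 fun v hv => ?_
  rw [sub_le_iff_le_add']
  have hw := hu.splice (by omega) (by omega) hv (hL i' hi' hci') (hR j hj hcj) hci hcj'
  have hw' := hv.splice (by omega) (by omega) hu (hL i hi hci) (hR j' hj' hcj') hci' hcj
  exact (add_le_add (minSum_le_chainCost (by omega) hw) (minSum_le_chainCost (by omega) hw')).trans
    chainCost_splice_add_le

/-- `D` is modular on its finite values. -/
lemma finiteCost_add_eq (h : IsSorted β z n l r x) {i j i' j' : ℕ} (hi : i ≤ l) (hj : r ≤ j)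
    (hi' : i' ≤ l) (hj' : r ≤ j')
    (h1 : minSensors β z ≤ (Finset.Icc i j).card) (h2 : minSensors β z ≤ (Finset.Icc i' j').card)
    (h3 : minSensors β z ≤ (Finset.Icc i j').card) (h4 : minSensors β z ≤ (Finset.Icc i' j).card) :
    finiteCost β z l r x i j' + finiteCost β z l r x i' j =
      finiteCost β z l r x i j + finiteCost β z l r x i' j' := by
  have a1 := h.containCost_add_le hi hj hi' hj' h1 h2 h3 h4
  have a2 := h.containCost_add_le hi hj' hi' hj h3 h4 h1 h2
  simp only [finiteCost]
  linarith

lemma containCost_midpoint_le (h : IsSorted β z n l r x) {i m : ℕ} (hi : i ≤ l) (hm : r ≤ m)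
    (hf : minSensors β z ≤ (Finset.Icc i m).card) :
    2 * containCost β z l r x i (m + 1) ≤
      containCost β z l r x i m + containCost β z l r x i (m + 2) := by
  have hlr := h.le
  rw [← sub_le_iff_le_add]
  refine h.le_containCost hi hm hf fun u hu => ?_
  rw [sub_le_comm]
  refine h.le_containCost hi (by omega)
    (hf.trans (Finset.card_le_card (Finset.Icc_subset_Icc_right (by omega)))) fun v hv => ?_
  obtain ⟨w, w', hw, hw', hle⟩ := exists_isChain_midpoint (x := manualMove β z l r x)
    h.z_pos (by omega) hu hv (manualMove_of_gt hlr (by omega))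
    ((minSensors_le_card_iff h.z_pos (by omega)).1 hf)
  have b1 : containCost β z l r x i (m + 1) ≤ _ := minSum_le_chainCost (by omega) hw
  have b2 : containCost β z l r x i (m + 1) ≤ _ := minSum_le_chainCost (by omega) hw'
  linarith

lemma costRight_succ (β z : ℝ) (x : ℕ → ℝ) {m : ℕ} (hm : r ≤ m) :
    costRight β z r x (m + 1) = costRight β z r x m + (x (m + 1) - z - β) := by
  rw [costRight, costRight, ← Finset.insert_Ioc_right_eq_Ioc_add_one hm,
    Finset.sum_insert (by simp), add_comm]

/-- `D(i, ·)` is convex on its finite values. -/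
lemma finiteCost_midpoint_le (h : IsSorted β z n l r x) {i m : ℕ} (hi : i ≤ l) (hm : r ≤ m)
    (hmn : m + 2 ≤ n) (hf : minSensors β z ≤ (Finset.Icc i m).card) :
    2 * finiteCost β z l r x i (m + 1) ≤
      finiteCost β z l r x i m + finiteCost β z l r x i (m + 2) := by
  have h1 := h.containCost_midpoint_le hi hm hf
  have h2 := costRight_succ β z x hm
  have h3 : costRight β z r x (m + 2) = _ := costRight_succ β z x (m := m + 1) (by omega)
  have h4 : x (m + 1) ≤ x (m + 2) := h.mono ⟨by omega, by omega⟩ ⟨by omega, hmn⟩ (by omega)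
  simp only [finiteCost]
  linarith

/-- By convexity, once the cost rises it keeps rising; a rise somewhere between `j` and `m` would
make the value at `k` exceed the one at `m`. -/
lemma finiteCost_le_of_lt_of_le (h : IsSorted β z n l r x) {i j m k : ℕ} (hi : i ≤ l) (hj : r ≤ j)
    (hjm : j < m) (hmk : m < k) (hkn : k ≤ n) (hf : minSensors β z ≤ (Finset.Icc i j).card)
    (hk : finiteCost β z l r x i k ≤ finiteCost β z l r x i m) :
    finiteCost β z l r x i m ≤ finiteCost β z l r x i j := by
  by_contra! hlt
  obtain ⟨s, hjs, hsm, hs⟩ : ∃ s, j ≤ s ∧ s < m ∧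
      finiteCost β z l r x i s < finiteCost β z l r x i (s + 1) := by
    by_contra! hcon
    have : ∀ t, j ≤ t → t ≤ m → finiteCost β z l r x i t ≤ finiteCost β z l r x i j := by
      intro t ht
      induction t, ht using Nat.le_induction with
      | base => exact fun _ => le_rfl
      | succ t ht ih => exact fun htm => (hcon t ht (by omega)).trans (ih (by omega))
    exact (this m hjm.le le_rfl).not_gt hlt
  have step : ∀ t, s ≤ t → t < k → finiteCost β z l r x i t < finiteCost β z l r x i (t + 1) := by
    intro t ht
    induction t, ht using Nat.le_induction with
    | base => exact fun _ => hs
    | succ t ht ih =>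
      intro htk
      have h1 := h.finiteCost_midpoint_le (m := t) hi (by omega) (by omega)
        (hf.trans (Finset.card_le_card (Finset.Icc_subset_Icc_right (by omega))))
      have h2 := ih (by omega)
      show _ < finiteCost β z l r x i (t + 2)
      linarith
  have up : ∀ t, m + 1 ≤ t → t ≤ k → finiteCost β z l r x i m < finiteCost β z l r x i t := by
    intro t ht
    induction t, ht using Nat.le_induction with
    | base => exact fun htk => step m hsm.le (by omega)
    | succ t ht ih => exact fun htk => (ih (by omega)).trans (step t (by omega) (by omega))
  exact hk.not_gt (up k hmk le_rfl)

lemma moveCost_manualMove (h : IsSorted β z n l r x) {i j : ℕ} (hi : i ∈ Set.Icc 1 l)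
    (hj : j ∈ Set.Icc r n) :
    moveCost (Finset.Icc i j) x (manualMove β z l r x) =
      costLeft z l x i + costRight β z r x j := by
  have hlr := h.le
  obtain ⟨hi1, hi2⟩ := hi
  obtain ⟨hj1, hj2⟩ := hj
  have e : ∀ t ∈ Finset.Icc i j, |x t - manualMove β z l r x t| =
      (if t < l then -z - x t else 0) + (if r < t then x t - z - β else 0) := by
    intro t ht
    rw [Finset.mem_Icc] at ht
    rcases lt_or_ge t l with h1 | h1
    · have := h.left t (by omega) h1
      rw [manualMove_of_lt h1, if_pos h1, if_neg (by omega), abs_of_nonpos (by linarith)]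
      ring
    rcases lt_or_ge r t with h2 | h2
    · have := h.right t h2 (by omega)
      rw [manualMove_of_gt hlr h2, if_pos h2, if_neg (by omega), abs_of_nonneg (by linarith)]
      ring
    rw [manualMove_of_mem h1 h2, if_neg (by omega), if_neg (by omega)]
    simp
  rw [moveCost, Finset.sum_congr rfl e, Finset.sum_add_distrib, ← Finset.sum_filter,
    ← Finset.sum_filter, costLeft, costRight]
  congr 2 <;> ext t <;> simp <;> omega

/-- By the triangle inequality, moving directly costs no more than the manual move followed by the
chain; sensors outside `[i, j]` stay put. -/
lemma minSum_le_finiteCost (h : IsSorted β z n l r x) {i j : ℕ} (hi : i ∈ Set.Icc 1 l)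
    (hj : j ∈ Set.Icc r n) (hf : minSensors β z ≤ (Finset.Icc i j).card) :
    minSum β z (Finset.Icc 1 n) x ≤ finiteCost β z l r x i j := by
  have hlr := h.le
  have hsub : Finset.Icc i j ⊆ Finset.Icc 1 n := Finset.Icc_subset_Icc hi.1 hj.2
  rw [finiteCost, ← sub_le_iff_le_add]
  refine h.le_containCost hi.2 hj.1 hf fun u hu => ?_
  have hc := hu.covers (by have := hi.2; have := hj.1; omega)
  rw [← moveCost_chain, sub_le_iff_le_add, ← h.moveCost_manualMove hi hj]
  generalize (fun t : ℕ => u t + 2 * z * t) = y at hc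
  let y' : ℕ → ℝ := fun t => if t ∈ Finset.Icc i j then y t else x t
  have hc' : Covers β z (Finset.Icc 1 n) y' := by
    rw [covers_iff] at hc ⊢
    intro p h0 hp
    obtain ⟨t, ht, h1⟩ := hc p h0 hp
    exact ⟨t, hsub ht, by simpa only [y', if_pos ht] using h1⟩
  refine (minSum_le_moveCost hc').trans ?_
  rw [moveCost, moveCost, moveCost, ← Finset.sum_subset hsub, ← Finset.sum_add_distrib]
  · refine Finset.sum_le_sum fun t ht => ?_
    simp only [y', if_pos ht]
    rw [add_comm]
    exact abs_sub_le _ _ _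
  · intro t _ ht
    simp only [y', if_neg ht, sub_self, abs_zero]

end IsSorted

/-! ### Best indices from an optimal pair -/

variable {β z : ℝ} {n l r : ℕ} {x : ℕ → ℝ} {lstar rstar : ℕ}

lemma IsOptimalPair.minSensors_le (h : IsOptimalPair β z n l r x lstar rstar) :
    minSensors β z ≤ (Finset.Icc lstar rstar).card := by
  by_contra hcon
  have := h.2.2
  rw [totalCost_of_lt (not_le.1 hcon)] at this
  exact EReal.coe_ne_top _ this.symm

lemma IsOptimalPair.finiteCost_eq (h : IsOptimalPair β z n l r x lstar rstar) :
    finiteCost β z l r x lstar rstar = minSum β z (Finset.Icc 1 n) x := by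
  have := h.2.2
  rw [totalCost_of_le h.minSensors_le] at this
  exact_mod_cast this

lemma IsOptimalPair.mem_bestRight (hS : IsSorted β z n l r x)
    (h : IsOptimalPair β z n l r x lstar rstar) : rstar ∈ bestRight β z n l r x lstar := by
  refine ⟨h.2.1, fun j hj => ?_⟩
  rcases lt_or_ge (Finset.Icc lstar j).card (minSensors β z) with hf | hf
  · rw [totalCost_of_lt hf]
    exact le_top
  · rw [h.2.2, totalCost_of_le hf]
    exact_mod_cast hS.minSum_le_finiteCost h.1 hj hf

lemma bestRight_eq (hS : IsSorted β z n l r x) (h : IsOptimalPair β z n l r x lstar rstar)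
    (hI : minSensors β z ≤ (Finset.Icc l r).card) {i : ℕ} (hi : i ∈ Set.Icc 1 l) :
    bestRight β z n l r x i = {j | IsOptimalPair β z n l r x lstar j} := by
  have hf : ∀ {i j}, i ∈ Set.Icc 1 l → j ∈ Set.Icc r n →
      minSensors β z ≤ (Finset.Icc i j).card := fun hi hj =>
    hI.trans (Finset.card_le_card (Finset.Icc_subset_Icc hi.2 hj.1))
  have hmod : ∀ {j j'}, j ∈ Set.Icc r n → j' ∈ Set.Icc r n →
      finiteCost β z l r x i j' + finiteCost β z l r x lstar j =
        finiteCost β z l r x i j + finiteCost β z l r x lstar j' := fun hj hj' =>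
    hS.finiteCost_add_eq hi.2 hj.1 h.1.2 hj'.1 (hf hi hj) (hf h.1 hj') (hf hi hj') (hf h.1 hj)
  have hopt := h.finiteCost_eq
  ext j
  constructor
  · rintro ⟨hj, hbest⟩
    refine ⟨h.1, hj, ?_⟩
    have h1 := hbest rstar h.2.1
    rw [totalCost_of_le (hf hi hj), totalCost_of_le (hf hi h.2.1), EReal.coe_le_coe_iff] at h1
    have h2 := hS.minSum_le_finiteCost h.1 hj (hf h.1 hj)
    have h3 := hmod hj h.2.1
    rw [totalCost_of_le (hf h.1 hj), EReal.coe_eq_coe_iff]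
    linarith
  · intro hj
    refine ⟨hj.2.1, fun j' hj' => ?_⟩
    rw [totalCost_of_le (hf hi hj.2.1), totalCost_of_le (hf hi hj'), EReal.coe_le_coe_iff]
    have h1 := hj.finiteCost_eq
    have h2 := hS.minSum_le_finiteCost h.1 hj' (hf h.1 hj')
    have h3 := hmod hj.2.1 hj'
    linarith

lemma bestLeft_eq (hS : IsSorted β z n l r x) (h : IsOptimalPair β z n l r x lstar rstar)
    (hI : minSensors β z ≤ (Finset.Icc l r).card) {j : ℕ} (hj : j ∈ Set.Icc r n) :
    bestLeft β z l r x j = {i | IsOptimalPair β z n l r x i rstar} := by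
  have hf : ∀ {i j}, i ∈ Set.Icc 1 l → j ∈ Set.Icc r n →
      minSensors β z ≤ (Finset.Icc i j).card := fun hi hj =>
    hI.trans (Finset.card_le_card (Finset.Icc_subset_Icc hi.2 hj.1))
  have hmod : ∀ {i i'}, i ∈ Set.Icc 1 l → i' ∈ Set.Icc 1 l →
      finiteCost β z l r x i rstar + finiteCost β z l r x i' j =
        finiteCost β z l r x i j + finiteCost β z l r x i' rstar := fun hi hi' =>
    hS.finiteCost_add_eq hi.2 hj.1 hi'.2 h.2.1.1 (hf hi hj) (hf hi' h.2.1) (hf hi h.2.1) (hf hi' hj)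
  have hopt := h.finiteCost_eq
  ext i
  constructor
  · rintro ⟨hi, hbest⟩
    refine ⟨hi, h.2.1, ?_⟩
    have h1 := hbest lstar h.1
    rw [totalCost_of_le (hf hi hj), totalCost_of_le (hf h.1 hj), EReal.coe_le_coe_iff] at h1
    have h2 := hS.minSum_le_finiteCost hi h.2.1 (hf hi h.2.1)
    have h3 := hmod hi h.1
    rw [totalCost_of_le (hf hi h.2.1), EReal.coe_eq_coe_iff]
    linarith
  · intro hi
    refine ⟨hi.1, fun i' hi' => ?_⟩
    rw [totalCost_of_le (hf hi.1 hj), totalCost_of_le (hf hi' hj), EReal.coe_le_coe_iff]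
    have h1 := hi.finiteCost_eq
    have h2 := hS.minSum_le_finiteCost hi' h.2.1 (hf hi' h.2.1)
    have h3 := hmod hi.1 hi'
    linarith

/-- The difference of `D(·, j)` and `D(·, r*)` for `i` and `l*`. -/
lemma IsOptimalPair.finiteCost_sub_eq (hS : IsSorted β z n l r x)
    (h : IsOptimalPair β z n l r x lstar rstar) {i j : ℕ} (hi : i ≤ lstar) (hj : r ≤ j)
    (hf : minSensors β z ≤ (Finset.Icc lstar j).card) :
    finiteCost β z l r x i j - finiteCost β z l r x i rstar =
      finiteCost β z l r x lstar j - minSum β z (Finset.Icc 1 n) x := by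
  have h1 := hS.finiteCost_add_eq (hi.trans h.1.2) hj h.1.2 h.2.1.1
    (hf.trans (Finset.card_le_card (Finset.Icc_subset_Icc_left hi))) h.minSensors_le
    (h.minSensors_le.trans (Finset.card_le_card (Finset.Icc_subset_Icc_left hi))) hf
  rw [← h.finiteCost_eq]
  linarith

/-- If `S(l*, j)` is too small, then some `m` between `j` and `r*` is at least as good as `j`
for `i`. -/
lemma IsOptimalPair.exists_finiteCost_le (hS : IsSorted β z n l r x)
    (h : IsOptimalPair β z n l r x lstar rstar)
    (hcard : minSensors β z + 1 ≤ (Finset.Icc lstar rstar).card) {i j : ℕ} (hi : i ≤ lstar)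
    (hj : r ≤ j) (hij : minSensors β z ≤ (Finset.Icc i j).card)
    (hlj : (Finset.Icc lstar j).card < minSensors β z) :
    ∃ m, r ≤ m ∧ m < rstar ∧ minSensors β z ≤ (Finset.Icc lstar m).card ∧
      finiteCost β z l r x i m ≤ finiteCost β z l r x i j := by
  have hlr := hS.le
  have hl := h.1.2
  have hr := h.2.1.2
  rw [Nat.card_Icc] at hcard hlj
  have hm : minSensors β z ≤ (Finset.Icc lstar (lstar + minSensors β z - 1)).card := by
    rw [Nat.card_Icc]
    omega
  -- This is the least `m` for which S(l*, m) has λ sensors: it exceeds `j` by `hlj` and stays below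
  -- r* by the extra sensor in `hcard`.
  refine ⟨lstar + minSensors β z - 1, by omega, by omega, hm, ?_⟩
  refine hS.finiteCost_le_of_lt_of_le (hi.trans hl) hj (by omega) (k := rstar) (by omega) hr hij ?_
  have h1 := h.finiteCost_sub_eq hS hi (by omega) hm
  have h2 := hS.minSum_le_finiteCost h.1 ⟨by omega, by omega⟩ hm
  linarith

lemma IsOptimalPair.mem_bestRight_of_le (hS : IsSorted β z n l r x)
    (h : IsOptimalPair β z n l r x lstar rstar)
    (hcard : minSensors β z + 1 ≤ (Finset.Icc lstar rstar).card) {i : ℕ} (hi : i ≤ lstar) :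
    rstar ∈ bestRight β z n l r x i := by
  refine ⟨h.2.1, fun j hj => ?_⟩
  rcases lt_or_ge (Finset.Icc i j).card (minSensors β z) with hij | hij
  · rw [totalCost_of_lt hij]
    exact le_top
  rw [totalCost_of_le hij, totalCost_of_le
    (h.minSensors_le.trans (Finset.card_le_card (Finset.Icc_subset_Icc_left hi))),
    EReal.coe_le_coe_iff]
  have key : ∀ k ∈ Set.Icc r n, minSensors β z ≤ (Finset.Icc lstar k).card →
      finiteCost β z l r x i rstar ≤ finiteCost β z l r x i k := by
    intro k hk hf
    have h1 := h.finiteCost_sub_eq hS hi hk.1 hf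
    have h2 := hS.minSum_le_finiteCost h.1 hk hf
    linarith
  rcases lt_or_ge (Finset.Icc lstar j).card (minSensors β z) with hlj | hlj
  · obtain ⟨m, hrm, hmr, hf, hle⟩ := h.exists_finiteCost_le hS hcard hi hj.1 hij hlj
    exact (key m ⟨hrm, hmr.le.trans h.2.1.2⟩ hf).trans hle
  · exact key j hj hlj

lemma IsOptimalPair.mem_bestRight_of_finiteCost_le (hS : IsSorted β z n l r x)
    (h : IsOptimalPair β z n l r x lstar rstar) {i j : ℕ} (hi : i ≤ lstar) (hj : j ∈ Set.Icc r n)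
    (hf : minSensors β z ≤ (Finset.Icc lstar j).card)
    (hle : finiteCost β z l r x i j ≤ finiteCost β z l r x i rstar) :
    j ∈ bestRight β z n l r x lstar := by
  have h1 := h.finiteCost_sub_eq hS hi hj.1 hf
  refine IsOptimalPair.mem_bestRight hS ⟨h.1, hj, ?_⟩
  rw [totalCost_of_le hf, EReal.coe_eq_coe_iff]
  have h2 := hS.minSum_le_finiteCost h.1 hj hf
  linarith

lemma IsOptimalPair.finiteCost_le_of_mem_bestRight (h : IsOptimalPair β z n l r x lstar rstar)
    {i j : ℕ} (hi : i ≤ lstar) (hj : j ∈ bestRight β z n l r x i) :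
    minSensors β z ≤ (Finset.Icc i j).card ∧
      finiteCost β z l r x i j ≤ finiteCost β z l r x i rstar := by
  have h1 := hj.2 rstar h.2.1
  rw [totalCost_of_le (h.minSensors_le.trans
    (Finset.card_le_card (Finset.Icc_subset_Icc_left hi)))] at h1
  rcases lt_or_ge (Finset.Icc i j).card (minSensors β z) with hij | hij
  · rw [totalCost_of_lt hij, top_le_iff] at h1
    exact absurd h1 (EReal.coe_ne_top _)
  · rw [totalCost_of_le hij, EReal.coe_le_coe_iff] at h1
    exact ⟨hij, h1⟩

lemma IsOptimalPair.isLeast_bestRight (hS : IsSorted β z n l r x)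
    (h : IsOptimalPair β z n l r x lstar rstar)
    (hcard : minSensors β z + 1 ≤ (Finset.Icc lstar rstar).card) {i : ℕ} (hi : i ≤ lstar)
    (hleast : IsLeast (bestRight β z n l r x lstar) rstar) :
    IsLeast (bestRight β z n l r x i) rstar := by
  refine ⟨h.mem_bestRight_of_le hS hcard hi, fun j hj => ?_⟩
  obtain ⟨hij, hle⟩ := h.finiteCost_le_of_mem_bestRight hi hj
  rcases lt_or_ge (Finset.Icc lstar j).card (minSensors β z) with hlj | hlj
  · obtain ⟨m, hrm, hmr, hf, hle'⟩ := h.exists_finiteCost_le hS hcard hi hj.1.1 hij hlj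
    -- A best `j` with S(l*, j) too small would make `m` < r* a best right index for l*.
    exact absurd (hleast.2 (h.mem_bestRight_of_finiteCost_le hS hi ⟨hrm, hmr.le.trans h.2.1.2⟩ hf
      (hle'.trans hle))) hmr.not_ge
  · exact hleast.2 (h.mem_bestRight_of_finiteCost_le hS hi hj.1 hlj hle)

lemma IsOptimalPair.isGreatest_bestRight (hS : IsSorted β z n l r x)
    (h : IsOptimalPair β z n l r x lstar rstar)
    (hcard : minSensors β z + 1 ≤ (Finset.Icc lstar rstar).card) {i : ℕ} (hi : i ≤ lstar)
    (hgreatest : IsGreatest (bestRight β z n l r x lstar) rstar) :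
    IsGreatest (bestRight β z n l r x i) rstar := by
  refine ⟨h.mem_bestRight_of_le hS hcard hi, fun j hj => ?_⟩
  by_contra! hlt
  obtain ⟨-, hle⟩ := h.finiteCost_le_of_mem_bestRight hi hj
  exact hlt.not_ge (hgreatest.2 (h.mem_bestRight_of_finiteCost_le hS hi hj.1
    -- Here j > r*, so S(l*, j) is large enough and convexity is not needed.
    (h.minSensors_le.trans (Finset.card_le_card (Finset.Icc_subset_Icc_right hlt.le))) hle))

end BarrierCoverage

theorem mainTheorem6 (β z : ℝ) (n l r : ℕ) (x : ℕ → ℝ)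
    (hz : 0 < z) (hzβ : 2 * z < β) (hβn : β ≤ 2 * z * n)
    (hx : MonotoneOn x (Set.Icc 1 n))
    (hl : IsLeast (BarrierCoverage.meeting β z n x) l)
    (hr : IsGreatest (BarrierCoverage.meeting β z n x) r)
    (lstar rstar : ℕ)
    (hopt : BarrierCoverage.IsOptimalPair β z n l r x lstar rstar) :
    (BarrierCoverage.minSensors β z ≤ (Finset.Icc l r).card →
      (∀ i ∈ Set.Icc 1 l,
        rstar ∈ BarrierCoverage.bestRight β z n l r x i ∧
        BarrierCoverage.bestRight β z n l r x i =
          {j | BarrierCoverage.IsOptimalPair β z n l r x lstar j}) ∧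
      (∀ j ∈ Set.Icc r n,
        lstar ∈ BarrierCoverage.bestLeft β z l r x j ∧
        BarrierCoverage.bestLeft β z l r x j =
          {i | BarrierCoverage.IsOptimalPair β z n l r x i rstar})) ∧
    (BarrierCoverage.minSensors β z + 1 ≤ (Finset.Icc lstar rstar).card →
      ∀ i, 1 ≤ i → i < lstar →
        rstar ∈ BarrierCoverage.bestRight β z n l r x i ∧
        (IsLeast (BarrierCoverage.bestRight β z n l r x lstar) rstar →
          IsLeast (BarrierCoverage.bestRight β z n l r x i) rstar) ∧
        (IsGreatest (BarrierCoverage.bestRight β z n l r x lstar) rstar →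
          IsGreatest (BarrierCoverage.bestRight β z n l r x i) rstar)) ∧
    (BarrierCoverage.minSensors β z ≤ (Finset.Icc l r).card ∨
        BarrierCoverage.minSensors β z + 1 ≤ (Finset.Icc lstar rstar).card →
      rstar ∈ BarrierCoverage.bestRight β z n l r x 1 ∧
      (IsLeast (BarrierCoverage.bestRight β z n l r x lstar) rstar →
        IsLeast (BarrierCoverage.bestRight β z n l r x 1) rstar) ∧
      (IsGreatest (BarrierCoverage.bestRight β z n l r x lstar) rstar →
        IsGreatest (BarrierCoverage.bestRight β z n l r x 1) rstar)) := by
  have hS := BarrierCoverage.isSorted_of_meeting hz (by linarith) hx hl hr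
  refine ⟨fun hI => ⟨fun i hi => ?_, fun j hj => ?_⟩, fun hcard i _ hi => ?_, ?_⟩
  · rw [BarrierCoverage.bestRight_eq hS hopt hI hi]
    exact ⟨hopt, rfl⟩
  · rw [BarrierCoverage.bestLeft_eq hS hopt hI hj]
    exact ⟨hopt, rfl⟩
  · exact ⟨hopt.mem_bestRight_of_le hS hcard hi.le, hopt.isLeast_bestRight hS hcard hi.le,
      hopt.isGreatest_bestRight hS hcard hi.le⟩
  · rintro (hI | hcard)
    · rw [BarrierCoverage.bestRight_eq hS hopt hI ⟨le_rfl, hS.one_le⟩,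
        BarrierCoverage.bestRight_eq hS hopt hI hopt.1]
      exact ⟨hopt, id, id⟩
    · have h1 : 1 ≤ lstar := hopt.1.1
      exact ⟨hopt.mem_bestRight_of_le hS hcard h1, hopt.isLeast_bestRight hS hcard h1,
        hopt.isGreatest_bestRight hS hcard h1⟩
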